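/- Let $F$ be a free group of finite rank, let $A \le F$ be a nontrivial free factor, and let $\phi : A \to F$ be an injective homomorphism. Definitions. For a group $G$, a \emph{subgroup system} of $G$ is either the trivial system $\{1\}$ or a nonempty finite set of nontrivial subgroups of $G$. A \emph{free factor system} of $G$ is either the trivial system $\{1\}$ or a nonempty finite set $\{A_1,\dots,A_l\}$ of nontrivial subgroups such that $G = A_1 * \cdots * A_l * B$ for some subgroup $B \le G$. A set $\mathcal A$ of subgroups of $G$ \emph{carries} a set $\mathcal B$ of subgroups of $G$ (in $G$) if for every $B \in \mathcal B$ there are $A' \in \mathcal A$ and $x \in G$ with $B \le xA'x^{-1}$; it carries a conjugacy class $[g]$ of $G$ if $g \in xA'x^{-1}$ for some $A' \in \mathcal A$ and $x \in G$. The relation "$\mathcal B$ is carried by $\mathcal A$ in $G$", written $\mathcal B \preceq \mathcal A$, is a preorder on free factor systems of $G$; systems with $\mathcal A \preceq \mathcal B \preceq \mathcal A$ are called equivalent. A subgroup system $\mathcal A$ of $A$ is \emph{$[\phi]$-invariant} if $\mathcal A$ carries $\{\phi(H) : H \in \mathcal A\}$ in $F$. A conjugacy class $[g]$ of $F$ always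 has $0$ forward iterates, with $\phi^0\cdot[g] = [g]$; it has $n+1$ forward iterates if it has $n$ forward iterates and $\phi^n\cdot[g]$ contains an element $a \in A$, in which case $\phi^{n+1}\cdot[g] = [\phi(a)]$ (this is well defined because $A$ is malnormal in $F$). Claim. There is a $[\phi]$-invariant free factor system $\mathcal F$ of $A$ that is maximal with respect to $\preceq$ (in $A$) among all $[\phi]$-invariant free factor systems of $A$, and every such maximal system is equivalent to $\mathcal F$ in $A$. Moreover, $\mathcal F$ carries in $F$ every conjugacy class of $F$ that has $2\cdot\mathrm{rank}(A)$ forward iterates, and $\mathcal F$ carries in $A$ every $[\phi]$-invariant subgroup system of $A$. -/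

import Mathlib

/-- The rank of a free group: the cardinality of a basis. -/
noncomputable def freeGroupRank (G : Type*) [Group G] [IsFreeGroup G] : ℕ :=
  Nat.card (IsFreeGroup.Generators G)

/-- `A` is a free factor of `G`: for some subgroup `B`, the canonical homomorphism
`A ∗ B → G` is an isomorphism. -/
def IsFreeFactor {G : Type*} [Group G] (A : Subgroup G) : Prop :=
  ∃ B : Subgroup G, Function.Bijective (Monoid.Coprod.lift A.subtype B.subtype)

/-- A subgroup system of `G`: the trivial system `{1}`, or a nonempty finite collection of
nontrivial subgroups. -/
def IsSubgroupSystem {G : Type*} [Group G] (𝒜 : Set (Subgroup G)) : Prop :=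
  𝒜 = {⊥} ∨ (𝒜.Nonempty ∧ 𝒜.Finite ∧ ∀ H ∈ 𝒜, H ≠ ⊥)

/-- A free factor system of `G`: the trivial system `{1}`, or a nonempty finite collection
`{A₁, …, A_l}` of nontrivial subgroups such that `G = A₁ ∗ ⋯ ∗ A_l ∗ B` for some subgroup `B`
(that is, the canonical homomorphism from this free product to `G` is an isomorphism). -/
def IsFreeFactorSystem {G : Type*} [Group G] (𝒜 : Set (Subgroup G)) : Prop :=
  𝒜 = {⊥} ∨ (𝒜.Nonempty ∧ 𝒜.Finite ∧ (∀ H ∈ 𝒜, H ≠ ⊥) ∧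
    ∃ B : Subgroup G, Function.Bijective
      (Monoid.Coprod.lift
        (Monoid.CoprodI.lift (fun H : 𝒜 => (H : Subgroup G).subtype)) B.subtype))

/-- `𝒜` carries `ℬ` (conjugation taking place in `G`): every `B ∈ ℬ` satisfies
`B ≤ x A x⁻¹` for some `A ∈ 𝒜` and some `x : G`. -/
def Carries {G : Type*} [Group G] (𝒜 ℬ : Set (Subgroup G)) : Prop :=
  ∀ B ∈ ℬ, ∃ A ∈ 𝒜, ∃ x : G, B ≤ A.map (MulAut.conj x).toMonoidHom

/-- `𝒜` carries the conjugacy class `c`: some element of `c` lies in a component of `𝒜`. -/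
def CarriesClass {G : Type*} [Group G] (𝒜 : Set (Subgroup G)) (c : ConjClasses G) : Prop :=
  ∃ H ∈ 𝒜, ∃ h ∈ H, ConjClasses.mk h = c

/-- A collection of subgroups of `A`, seen as a collection of subgroups of `F`. -/
def inAmbient {F : Type*} [Group F] {A : Subgroup F} (𝒜 : Set (Subgroup A)) :
    Set (Subgroup F) :=
  (fun H : Subgroup A => H.map A.subtype) '' 𝒜

/-- A collection `𝒜` of subgroups of `A` is `[φ]`-invariant, for `φ : A → F`, if `𝒜` carries
`φ(𝒜) = {φ(H) : H ∈ 𝒜}` in `F`. -/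
def IsInvariantSystem {F : Type*} [Group F] {A : Subgroup F} (φ : A →* F)
    (𝒜 : Set (Subgroup A)) : Prop :=
  Carries (inAmbient 𝒜) ((fun H : Subgroup A => H.map φ) '' 𝒜)

/-- `IsForwardIterate φ n c d` says that `d` is the `n`-th forward iterate `φⁿ · c` of the
conjugacy class `c`. If `φⁿ · c` contains an element `a` of `A`, then `φⁿ⁺¹ · c` is the class
of `φ a`. (When `A` is malnormal in `F`, such a `d` is determined by `n` and `c`.) -/
inductive IsForwardIterate {F : Type*} [Group F] {A : Subgroup F} (φ : A →* F) :
    ℕ → ConjClasses F → ConjClasses F → Prop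
  | zero (c : ConjClasses F) : IsForwardIterate φ 0 c c
  | succ (n : ℕ) (c : ConjClasses F) (a : A) :
      IsForwardIterate φ n c (ConjClasses.mk (a : F)) →
      IsForwardIterate φ (n + 1) c (ConjClasses.mk (φ a))

/-- The conjugacy class `c` has `n` forward iterates. -/
def HasForwardIterates {F : Type*} [Group F] {A : Subgroup F} (φ : A →* F) (n : ℕ)
    (c : ConjClasses F) : Prop :=
  ∃ d : ConjClasses F, IsForwardIterate φ n c d

/-- `𝒜` is maximal, for the preorder "is carried by" (conjugation in `A`), among the
`[φ]`-invariant free factor systems of `A`. -/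
def IsMaximalInvariantFreeFactorSystem {F : Type*} [Group F] {A : Subgroup F} (φ : A →* F)
    (𝒜 : Set (Subgroup A)) : Prop :=
  IsFreeFactorSystem 𝒜 ∧ IsInvariantSystem φ 𝒜 ∧
    ∀ ℬ : Set (Subgroup A), IsFreeFactorSystem ℬ → IsInvariantSystem φ ℬ →
      Carries ℬ 𝒜 → Carries 𝒜 ℬ

/-!
Pulling a free factor system `𝓢` of `A` back along `φ : A → F` gives, by the Kurosh subgroup
theorem, a free factor system of `A` that carries exactly the systems which `φ` maps into conjugates
of components of `𝓢`. Starting from `{A}` this produces a decreasing sequence, and a system is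
invariant once it is carried by its own pullback. The complexity `∑ (2 rank Aᵢ - 1)` starts at
`2 rank A - 1` and drops at every step at which the sequence is not yet stationary, so an invariant
system appears before step `2 rank A`. It carries every invariant system, by induction along the
sequence, and a conjugacy class with `n + 1` forward iterates is carried by the `n`-th pullback.

The Kurosh theorem is obtained from the action of `G = H₁ ∗ ⋯ ∗ H_l ∗ B` on the cosets of a
subgroup: a Schreier transversal adapted to the factors provides a free product of vertex groups
and of edge generators, and an inverse of its canonical map to the point stabilizer is defined
through a cocycle, which needs to be specified on the factors only.
-/

open Monoid

theorem bijective_of_comp_eq_id {M N : Type*} [Monoid M] [Monoid N] {f : M →* N} {g : N →* M}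
    (hgf : g.comp f = MonoidHom.id M) (hfg : f.comp g = MonoidHom.id N) : Function.Bijective f :=
  (f.toMulEquiv g hgf hfg).bijective

section InternalFreeProduct

variable {G ι : Type*} [Group G]

/-- `G` is the internal free product of the subgroups `H i`. -/
def IsInternalFreeProduct (H : ι → Subgroup G) : Prop :=
  Function.Bijective (CoprodI.lift fun i => (H i).subtype)

namespace IsInternalFreeProduct

variable {H : ι → Subgroup G}

theorem iSup_eq_top (hH : IsInternalFreeProduct H) : ⨆ i, H i = ⊤ := by
  simpa only [Subgroup.range_subtype] using
    (CoprodI.range_eq_iSup (f := fun i => (H i).subtype)).symm.trans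
      (MonoidHom.range_eq_top.2 hH.2)

/-- The homomorphism on an internal free product extending given homomorphisms on the factors. -/
noncomputable def lift {M : Type*} [Monoid M] (hH : IsInternalFreeProduct H)
    (f : ∀ i, H i →* M) : G →* M :=
  (CoprodI.lift f).comp (MulEquiv.ofBijective _ hH).symm.toMonoidHom

theorem lift_apply {M : Type*} [Monoid M] (hH : IsInternalFreeProduct H) (f : ∀ i, H i →* M)
    {i : ι} (x : H i) : hH.lift f x = f i x := by
  have hx : (MulEquiv.ofBijective _ hH).symm x = CoprodI.of (M := fun i => H i) x := by
    rw [MulEquiv.symm_apply_eq]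
    exact (CoprodI.lift_of (fun i => (H i).subtype) x).symm
  exact (congrArg (CoprodI.lift f) hx).trans (CoprodI.lift_of f x)

end IsInternalFreeProduct

theorem eq_of_eqOn_of_iSup_eq_top {M : Type*} [Monoid M] {H : ι → Subgroup G}
    (hH : ⨆ i, H i = ⊤) {f g : G →* M} (hfg : ∀ i, ∀ x ∈ H i, f x = g x) : f = g := by
  refine MonoidHom.eq_of_eqOn_top fun x _ => ?_
  have hle : ⨆ i, H i ≤ f.eqLocus g := iSup_le hfg
  exact hle (hH ▸ Subgroup.mem_top x)

theorem isInternalFreeProduct_of_section {H : ι → Subgroup G} (hH : ⨆ i, H i = ⊤)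
    (ψ : G →* CoprodI fun i => H i)
    (hψ : ∀ i (x : H i), ψ x = CoprodI.of (M := fun i => H i) x) :
    IsInternalFreeProduct H := by
  refine bijective_of_comp_eq_id (g := ψ) (CoprodI.ext_hom _ _ fun i => ?_)
    (eq_of_eqOn_of_iSup_eq_top hH fun i x hx => ?_)
  · ext x
    simp [hψ]
  · simp [hψ i ⟨x, hx⟩]

theorem IsInternalFreeProduct.iSup_fiber {κ : Type*} {H : ι → Subgroup G}
    (hH : IsInternalFreeProduct H) (f : ι → κ) :
    IsInternalFreeProduct fun k => ⨆ i : {i // f i = k}, H i := by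
  let P (k : κ) : Subgroup G := ⨆ i : {i // f i = k}, H i
  have hle (i : ι) : H i ≤ P (f i) := le_iSup (fun j : {j // f j = f i} => H j) ⟨i, rfl⟩
  let ψ : G →* CoprodI fun k => P k := hH.lift fun i =>
    (CoprodI.of (M := fun k => P k)).comp (Subgroup.inclusion (hle i))
  refine isInternalFreeProduct_of_section ?_ ψ fun k => ?_
  · rw [eq_top_iff, ← hH.iSup_eq_top]
    exact iSup_le fun i => (hle i).trans (le_iSup P (f i))
  · suffices h : P k ≤ ((ψ.comp (P k).subtype).eqLocus
        (CoprodI.of (M := fun k => P k))).map (P k).subtype by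
      rintro ⟨x, hx⟩
      obtain ⟨y, hy, rfl⟩ := h hx
      exact hy
    refine iSup_le ?_
    rintro ⟨i, rfl⟩ x hx
    exact ⟨⟨x, hle i hx⟩, hH.lift_apply (fun i =>
      (CoprodI.of (M := fun k => P k)).comp (Subgroup.inclusion (hle i))) ⟨x, hx⟩, rfl⟩

/-- The free product over `Option ι` splits off the factor at `none`. -/
def coprodIOptionEquiv (M : Option ι → Type*) [∀ o, Monoid (M o)] :
    Coprod (CoprodI fun i => M (some i)) (M none) ≃* CoprodI M :=
  MonoidHom.toMulEquiv
    (Coprod.lift (CoprodI.lift fun _ => CoprodI.of) CoprodI.of)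
    (CoprodI.lift fun
      | none => Coprod.inr
      | some i => Coprod.inl.comp (CoprodI.of (M := fun i => M (some i)) (i := i)))
    (Coprod.hom_ext (CoprodI.ext_hom _ _ fun i => by ext; simp) (by ext; simp))
    (CoprodI.ext_hom _ _ fun o => by cases o <;> ext <;> simp)

theorem bijective_coprodLift_coprodILift_iff {N : Type*} [Monoid N] {M : Option ι → Type*}
    [∀ o, Monoid (M o)] (f : ∀ o, M o →* N) :
    Function.Bijective (Coprod.lift (CoprodI.lift fun i => f (some i)) (f none)) ↔
      Function.Bijective (CoprodI.lift f) := by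
  have h : Coprod.lift (CoprodI.lift fun i => f (some i)) (f none) =
      (CoprodI.lift f).comp (coprodIOptionEquiv M).toMonoidHom :=
    Coprod.hom_ext (CoprodI.ext_hom _ _ fun i => by ext; simp [coprodIOptionEquiv])
      (by ext; simp [coprodIOptionEquiv])
  rw [h]
  exact Function.Bijective.of_comp_iff _ (coprodIOptionEquiv M).bijective

end InternalFreeProduct

section FreeFactorFamily

variable {G ι κ : Type*} [Group G] {H : ι → Subgroup G}

/-- The subgroups `H i` are the factors of a free product decomposition `G = (∗ᵢ H i) ∗ B` for
some subgroup `B`. -/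
def IsFreeFactorFamily (H : ι → Subgroup G) : Prop :=
  ∃ B : Subgroup G,
    Function.Bijective (Coprod.lift (CoprodI.lift fun i => (H i).subtype) B.subtype)

theorem isFreeFactorFamily_iff_exists_isInternalFreeProduct :
    IsFreeFactorFamily H ↔
      ∃ B : Subgroup G, IsInternalFreeProduct fun o : Option ι => o.elim B H :=
  exists_congr fun B =>
    bijective_coprodLift_coprodILift_iff fun o : Option ι => (o.elim B H : Subgroup G).subtype

theorem isFreeFactorFamily_range {M : ι → Type*} {N : Type*} [∀ i, Group (M i)] [Group N]
    {f : ∀ i, M i →* G} {g : N →* G} (hfg : Function.Bijective (Coprod.lift (CoprodI.lift f) g)) :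
    IsFreeFactorFamily fun i => (f i).range := by
  let E := MulEquiv.ofBijective _ hfg
  let R : Coprod (CoprodI M) N →* Coprod (CoprodI fun i => (f i).range) g.range :=
    Coprod.map (CoprodI.lift fun i =>
      (CoprodI.of (M := fun i => (f i).range)).comp (f i).rangeRestrict) g.rangeRestrict
  have hE_inl (i : ι) (x : M i) : E.symm (f i x) = Coprod.inl (CoprodI.of x) := by
    rw [MulEquiv.symm_apply_eq]
    simp [E]
  have hE_inr (x : N) : E.symm (g x) = Coprod.inr x := by
    rw [MulEquiv.symm_apply_eq]
    simp [E]
  refine ⟨g.range, bijective_of_comp_eq_id (g := R.comp E.symm.toMonoidHom)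
    (Coprod.hom_ext (CoprodI.ext_hom _ _ fun i => MonoidHom.ext ?_) (MonoidHom.ext ?_))
    (MonoidHom.ext fun x => ?_)⟩
  · rintro ⟨_, x, rfl⟩
    have hx : (f i).rangeRestrict x = ⟨f i x, x, rfl⟩ := rfl
    simp [R, hE_inl, hx]
  · rintro ⟨_, x, rfl⟩
    have hx : g.rangeRestrict x = ⟨g x, x, rfl⟩ := rfl
    simp [R, hE_inr, hx]
  · have hR : (Coprod.lift (CoprodI.lift fun i => (f i).range.subtype) g.range.subtype).comp R =
        Coprod.lift (CoprodI.lift f) g :=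
      Coprod.hom_ext (CoprodI.ext_hom _ _ fun i => by ext; simp [R]) (by ext; simp [R])
    exact (DFunLike.congr_fun hR _).trans (E.apply_symm_apply x)

theorem isFreeFactorFamily_top : IsFreeFactorFamily fun _ : Unit => (⊤ : Subgroup G) := by
  have h : Function.Bijective
      (Coprod.lift (CoprodI.lift fun _ : Unit => MonoidHom.id G) (1 : Unit →* G)) := by
    refine bijective_of_comp_eq_id
      (g := Coprod.inl.comp (CoprodI.of (M := fun _ : Unit => G) (i := ())))
      (Coprod.hom_ext (CoprodI.ext_hom _ _ fun _ => ?_) ?_) ?_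
    · ext; simp
    · ext x; rw [Subsingleton.elim x 1, map_one, map_one]
    · ext; simp
  simpa only [(MonoidHom.range_eq_top (f := MonoidHom.id G)).2 Function.surjective_id] using
    isFreeFactorFamily_range h

theorem IsFreeFactorFamily.comp_injective (hH : IsFreeFactorFamily H) {e : κ → ι}
    (he : Function.Injective e) : IsFreeFactorFamily fun k => H (e k) := by
  classical
  rw [isFreeFactorFamily_iff_exists_isInternalFreeProduct] at hH ⊢
  obtain ⟨B, hB⟩ := hH
  let f : Option ι → Option κ := fun o => o.bind (Function.partialInv e)
  refine ⟨⨆ i : {i // f i = none}, (i : Option ι).elim B H, ?_⟩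
  convert hB.iSup_fiber f using 2 with o
  rcases o with _ | k
  · rfl
  · refine le_antisymm ?_ (iSup_le ?_)
    · exact le_iSup (fun i : {i // f i = some k} => (i : Option ι).elim B H)
        ⟨some (e k), Function.partialInv_left he k⟩
    · rintro ⟨_ | i, hi⟩
      · simp [f] at hi
      · have hik : e k = i := (he.isPartialInv k i).1 hi
        simp [hik]

theorem IsFreeFactorFamily.map_subtype {A : Subgroup G} (hA : IsFreeFactor A)
    {H : ι → Subgroup A} (hH : IsFreeFactorFamily H) :
    IsFreeFactorFamily fun i => (H i).map A.subtype := by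
  obtain ⟨C, hC⟩ := hA
  obtain ⟨B, hB⟩ := hH
  let E : Coprod (CoprodI fun i => H i) (Coprod B C) ≃* G :=
    (MulEquiv.coprodAssoc _ _ _).symm.trans
      ((MulEquiv.coprodCongr (MulEquiv.ofBijective _ hB) (MulEquiv.refl C)).trans
        (MulEquiv.ofBijective _ hC))
  have hE : Coprod.lift (CoprodI.lift fun i => A.subtype.comp (H i).subtype)
      (Coprod.lift (A.subtype.comp B.subtype) C.subtype) = E.toMonoidHom := by
    refine Coprod.hom_ext (CoprodI.ext_hom _ _ fun i => ?_) (Coprod.hom_ext ?_ ?_) <;>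
      ext <;> simp [E]
  simpa only [MonoidHom.range_comp, Subgroup.range_subtype] using
    isFreeFactorFamily_range (f := fun i => A.subtype.comp (H i).subtype)
      (g := Coprod.lift (A.subtype.comp B.subtype) C.subtype) (hE ▸ E.bijective)

end FreeFactorFamily

section Cocycle

open MulAction

variable {G S L : Type*} [Group G] [MulAction G S] [Group L]

/-- The cocycle identity for `θ : G → S → L`: equivalently, `x • (s, l) = (x • s, θ x s * l)`
defines an action of `G` on `S × L`. -/
def IsCocycle (θ : G → S → L) : Prop :=
  ∀ x y s, θ (x * y) s = θ x (y • s) * θ y s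

namespace IsCocycle

variable {θ θ' : G → S → L}

theorem one_apply (hθ : IsCocycle θ) (s : S) : θ 1 s = 1 := by
  simpa using hθ 1 1 s

theorem inv_apply (hθ : IsCocycle θ) (x : G) (s : S) : θ x⁻¹ (x • s) = (θ x s)⁻¹ := by
  rw [eq_inv_iff_mul_eq_one, ← hθ, inv_mul_cancel, hθ.one_apply]

theorem inv_mul_mul_apply (hθ : IsCocycle θ) {x y z : G} {r s t : S} (hx : x • t = z • s)
    (hy : y • r = s) : θ (x⁻¹ * z * y) r = (θ x t)⁻¹ * θ z s * θ y r := by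
  rw [hθ, hθ, hy, ← hx, hθ.inv_apply]

theorem comp_hom {L' : Type*} [Group L'] (hθ : IsCocycle θ) (f : L →* L') :
    IsCocycle fun x s => f (θ x s) :=
  fun x y s => by simp only [hθ x y s, map_mul]

theorem restrict (hθ : IsCocycle θ) (H : Subgroup G) : IsCocycle fun (h : H) s => θ h s :=
  fun x y s => hθ x y s

/-- A cocycle restricts to a homomorphism on the stabilizer of a point. -/
def stabilizerHom (hθ : IsCocycle θ) (s : S) : stabilizer G s →* L :=
  MonoidHom.mk' (fun x => θ x s) fun x y => by rw [Subgroup.coe_mul, hθ, y.2]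

theorem eq_of_eqOn_of_iSup_eq_top {J : Type*} {H : J → Subgroup G} (hθ : IsCocycle θ)
    (hθ' : IsCocycle θ') (hH : ⨆ j, H j = ⊤) (h : ∀ j, ∀ x ∈ H j, θ x = θ' x) : θ = θ' := by
  funext x
  refine Subgroup.iSup_induction H (C := fun x => θ x = θ' x) (hH ▸ Subgroup.mem_top x) h ?_ ?_
  · funext s
    rw [hθ.one_apply, hθ'.one_apply]
  · intro x y hx hy
    funext s
    rw [hθ, hθ', hx, hy]

end IsCocycle

theorem isCocycle_inv_mul_mul (γ : S → G) : IsCocycle fun x s => (γ (x • s))⁻¹ * x * γ s := by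
  intro x y s
  simp only [mul_smul]
  group

/-- Cocycles `G → S → L` correspond to sections of `(S → L) ⋊ G → G`, and a section over an
internal free product can be prescribed on each factor. -/
theorem IsInternalFreeProduct.exists_isCocycle {J : Type*} {H : J → Subgroup G}
    (hH : IsInternalFreeProduct H) {θ : ∀ j, H j → S → L} (hθ : ∀ j, IsCocycle (θ j)) :
    ∃ Θ : G → S → L, IsCocycle Θ ∧ ∀ j (h : H j) s, Θ h s = θ j h s := by
  let σ (j : J) : H j →* (S → L) ⋊[mulAutArrow] G :=
    MonoidHom.mk' (fun h => ⟨fun s => θ j h (h⁻¹ • s), h⟩) fun h k => by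
      ext s
      · simp only [SemidirectProduct.mul_left, Pi.mul_apply, mulAutArrow_apply_apply]
        rw [hθ, mul_inv_rev, mul_smul, smul_inv_smul]
        rfl
      · rfl
  let Φ := hH.lift σ
  have hΦ (j : J) (h : H j) : Φ h = σ j h := hH.lift_apply σ h
  have hright (x : G) : (Φ x).right = x :=
    DFunLike.congr_fun (eq_of_eqOn_of_iSup_eq_top hH.iSup_eq_top
      (f := SemidirectProduct.rightHom.comp Φ) (g := MonoidHom.id G)
      fun j h hh => congrArg SemidirectProduct.right (hΦ j ⟨h, hh⟩)) x
  refine ⟨fun x s => (Φ x).left (x • s), fun x y s => ?_, fun j h s => ?_⟩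
  · simp only [map_mul, SemidirectProduct.mul_left, Pi.mul_apply, mulAutArrow_apply_apply, hright,
      mul_smul]
    congr 1
    exact congrArg (Φ y).left (inv_smul_smul x (y • s))
  · change (Φ h).left (h • s) = _
    rw [hΦ]
    exact congrArg (θ j h) (inv_smul_smul h s)

end Cocycle

section Transversal

open MulAction

/-- A base point in each orbit of `H` on `S`, and for each point of `S` an element of `H` taking
the base point of its orbit to it. -/
structure OrbitTransversal (H S : Type*) [Group H] [MulAction H S] where
  base : orbitRel.Quotient H S → S
  transporter : S → H
  transporter_smul_base : ∀ s, transporter s • base ⟦s⟧ = s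
  transporter_base : ∀ ω, transporter (base ω) = 1

namespace OrbitTransversal

variable {H S L : Type*} [Group H] [MulAction H S] [Group L] (T : OrbitTransversal H S)

@[simp]
theorem mk_base (ω : orbitRel.Quotient H S) : (⟦T.base ω⟧ : orbitRel.Quotient H S) = ω := by
  induction ω using Quotient.inductionOn with
  | h s =>
    refine Quotient.sound (orbitRel_apply.2 ⟨(T.transporter s)⁻¹, ?_⟩)
    exact inv_smul_eq_iff.2 (T.transporter_smul_base s).symm

theorem mk_smul (h : H) (s : S) : (⟦h • s⟧ : orbitRel.Quotient H S) = ⟦s⟧ :=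
  Quotient.sound (orbitRel_apply.2 (mem_orbit s h))

theorem transporter_smul_base_mk (h : H) (s : S) :
    T.transporter (h • s) • T.base ⟦s⟧ = h • s := by
  rw [← mk_smul h s, T.transporter_smul_base]

/-- The difference between `h` and the transporters to `s` and `h • s`. -/
def loop (h : H) (s : S) : stabilizer H (T.base ⟦s⟧) :=
  ⟨(T.transporter (h • s))⁻¹ * h * T.transporter s, by
    rw [mem_stabilizer_iff, mul_smul, mul_smul, T.transporter_smul_base, inv_smul_eq_iff,
      T.transporter_smul_base_mk]⟩

theorem isCocycle_eq {θ θ' : H → S → L} (hθ : IsCocycle θ) (hθ' : IsCocycle θ')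
    (htransporter : ∀ s, θ (T.transporter s) (T.base ⟦s⟧) = θ' (T.transporter s) (T.base ⟦s⟧))
    (hstab : ∀ ω, ∀ x ∈ stabilizer H (T.base ω), θ x (T.base ω) = θ' x (T.base ω)) :
    θ = θ' := by
  have key {θ : H → S → L} (hθ : IsCocycle θ) (h : H) (s : S) :
      θ h s = θ (T.transporter (h • s)) (T.base ⟦h • s⟧) * θ (T.loop h s) (T.base ⟦s⟧) *
        (θ (T.transporter s) (T.base ⟦s⟧))⁻¹ := by
    have hloop := hθ.inv_mul_mul_apply (T.transporter_smul_base_mk h s)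
      (T.transporter_smul_base s)
    rw [mk_smul, loop, hloop]
    group
  funext h s
  rw [key hθ, key hθ', htransporter, htransporter, hstab _ _ (T.loop h s).2]

theorem exists_isCocycle (ρ : ∀ ω, stabilizer H (T.base ω) →* L) (e : S → L)
    (he : ∀ ω, e (T.base ω) = 1) :
    ∃ θ : H → S → L, IsCocycle θ ∧ (∀ s, θ (T.transporter s) (T.base ⟦s⟧) = e s) ∧
      ∀ ω (x : stabilizer H (T.base ω)), θ x (T.base ω) = ρ ω x := by
  have hρ {ω ω' : orbitRel.Quotient H S} (h : ω = ω') (x : stabilizer H (T.base ω))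
      (x' : stabilizer H (T.base ω')) (hx : (x : H) = x') : ρ ω x = ρ ω' x' := by
    subst h
    rw [Subtype.ext hx]
  refine ⟨fun h s => e (h • s) * ρ ⟦s⟧ (T.loop h s) * (e s)⁻¹, fun h k s => ?_, fun s => ?_,
    fun ω x => ?_⟩
  · have hmem : (T.loop h (k • s) : H) ∈ stabilizer H (T.base ⟦s⟧) := by
      simpa only [mk_smul] using (T.loop h (k • s)).2
    have hloop := hρ (mk_smul k s) (T.loop h (k • s)) ⟨_, hmem⟩ rfl
    have hmul : T.loop (h * k) s = ⟨_, hmem⟩ * T.loop k s := by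
      ext
      simp [loop, mul_smul, mul_assoc]
    simp only [hloop, hmul, map_mul, mul_smul]
    group
  · have hloop : T.loop (T.transporter s) (T.base ⟦s⟧) = 1 := by
      ext
      simp [loop, T.transporter_smul_base, T.transporter_base]
    simp [hloop, T.transporter_smul_base, he]
  · have hx : (x : H) • T.base ω = T.base ω := x.2
    have hloop : (T.loop x (T.base ω) : H) = x := by
      simp [loop, hx, T.transporter_base]
    simp [hx, he, hρ (T.mk_base ω) _ _ hloop]

end OrbitTransversal

end Transversal

section Kurosh

open MulAction

theorem OrbitTransversal.exists_base_le {H S : Type*} [Group H] [MulAction H S] (d : S → ℕ) :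
    ∃ T : OrbitTransversal H S, ∀ s, d (T.base ⟦s⟧) ≤ d s := by
  classical
  let base (ω : orbitRel.Quotient H S) : S :=
    Function.argminOn d ω.orbit (orbitRel.Quotient.nonempty_orbit ω)
  have hbase (s : S) : base ⟦s⟧ ∈ orbit H s := Function.argminOn_mem d _ _
  have hmin (s : S) : d (base ⟦s⟧) ≤ d s := Function.argminOn_le d _ (mem_orbit_self s)
  choose t ht using fun s => (mem_orbit_symm.1 (hbase s) : s ∈ orbit H (base ⟦s⟧))
  have hmk (ω : orbitRel.Quotient H S) : base ⟦base ω⟧ = base ω := by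
    induction ω using Quotient.inductionOn with
    | h s => exact congrArg base (Quotient.sound (orbitRel_apply.2 (hbase s)))
  refine ⟨⟨base, fun s => if base ⟦s⟧ = s then 1 else t s, fun s => ?_,
    fun ω => if_pos (hmk ω)⟩, hmin⟩
  split_ifs with h
  · rw [one_smul, h]
  · exact ht s

theorem exists_eq_mul_parent {F S : Type*} [Group F] (s₀ : S) (d : S → ℕ) (parent : S → S)
    (b : S → F) (hparent : ∀ s, s ≠ s₀ → d (parent s) < d s) :
    ∃ γ : S → F, γ s₀ = 1 ∧ ∀ s, s ≠ s₀ → γ s = b s * γ (parent s) := by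
  classical
  let wf : WellFounded fun s t : S => d s < d t := InvImage.wf d wellFounded_lt
  let step (s : S) (r : ∀ t, d t < d s → F) : F :=
    if h : s = s₀ then 1 else b s * r (parent s) (hparent s h)
  refine ⟨wf.fix step, ?_, fun s hs => ?_⟩
  · rw [wf.fix_eq]
    exact dif_pos rfl
  · rw [wf.fix_eq]
    exact dif_neg hs

variable {F S J : Type*} [Group F] [MulAction F S] {H : J → Subgroup F}

theorem exists_list_prod_eq_of_iSup_eq_top (hH : ⨆ j, H j = ⊤) (x : F) :
    ∃ l : List F, (∀ g ∈ l, ∃ j, g ∈ H j) ∧ l.prod = x := by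
  refine Subgroup.iSup_induction H (C := fun x => ∃ l : List F, (∀ g ∈ l, ∃ j, g ∈ H j) ∧
    l.prod = x) (hH ▸ Subgroup.mem_top x) (fun j x hx => ⟨[x], by simpa using ⟨j, hx⟩, by simp⟩)
    ⟨[], by simp, rfl⟩ ?_
  rintro _ _ ⟨l, hl, rfl⟩ ⟨m, hm, rfl⟩
  exact ⟨l ++ m, fun g hg => (List.mem_append.1 hg).elim (hl g) (hm g), List.prod_append⟩

theorem exists_depth [IsPretransitive F S] (hH : ⨆ j, H j = ⊤) (s₀ : S) :
    ∃ d : S → ℕ, ∀ s, s ≠ s₀ → ∃ j, ∃ h : H j, d (h • s) < d s := by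
  classical
  have hword (s : S) : ∃ n, ∃ l : List F, (∀ g ∈ l, ∃ j, g ∈ H j) ∧ l.length = n ∧
      l.prod • s₀ = s := by
    obtain ⟨x, rfl⟩ := exists_smul_eq F s₀ s
    obtain ⟨l, hl, rfl⟩ := exists_list_prod_eq_of_iSup_eq_top hH x
    exact ⟨l.length, l, hl, rfl, rfl⟩
  refine ⟨fun s => Nat.find (hword s), fun s hs => ?_⟩
  obtain ⟨_ | ⟨g, l⟩, hl, hlength, hprod⟩ := Nat.find_spec (hword s)
  · exact absurd (by simpa using hprod.symm) hs
  obtain ⟨⟨j, hg⟩, hl⟩ := List.forall_mem_cons.1 hl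
  have htail : l.prod • s₀ = g⁻¹ • s := by
    rw [eq_inv_smul_iff, ← hprod, List.prod_cons, mul_smul]
  have hle := Nat.find_min' (hword (g⁻¹ • s)) ⟨l, hl, rfl, htail⟩
  refine ⟨j, ⟨g⁻¹, inv_mem hg⟩, ?_⟩
  change Nat.find (hword (g⁻¹ • s)) < Nat.find (hword s)
  rw [← hlength, List.length_cons]
  lia

/-- The orbits of the subgroups `H j` on `S`, which index the vertex groups of the Kurosh
decomposition. -/
abbrev OrbitIndex (H : J → Subgroup F) (S : Type*) [MulAction F S] : Type _ :=
  Σ j, orbitRel.Quotient (H j) S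

/-- An orbit transversal for each of the subgroups `H j`, and for each point `s` an element
`rep s` taking `s₀` to `s`, which is the product of the transporters along a path from `s₀` to `s`
in a tree. -/
structure SchreierTransversal (H : J → Subgroup F) (s₀ : S) where
  orbit : ∀ j, OrbitTransversal (H j) S
  rep : S → F
  depth : S → ℕ
  rep_self : rep s₀ = 1
  exists_parent : ∀ s, s ≠ s₀ → ∃ j, depth ((orbit j).base ⟦s⟧) < depth s ∧
    rep s = (orbit j).transporter s * rep ((orbit j).base ⟦s⟧)

theorem nonempty_schreierTransversal [IsPretransitive F S] (hH : ⨆ j, H j = ⊤) (s₀ : S) :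
    Nonempty (SchreierTransversal H s₀) := by
  obtain ⟨d, hd⟩ := exists_depth hH s₀
  choose T hT using fun j => OrbitTransversal.exists_base_le (H := H j) d
  have hparent (s : S) : ∃ p : S × F, s ≠ s₀ → ∃ j, d p.1 < d s ∧
      p = ((T j).base ⟦s⟧, ((T j).transporter s : F)) := by
    by_cases hs : s = s₀
    · exact ⟨(s, 1), absurd hs⟩
    · obtain ⟨j, h, hlt⟩ := hd s hs
      refine ⟨_, fun _ => ⟨j, ?_, rfl⟩⟩
      exact ((OrbitTransversal.mk_smul h s ▸ hT j (h • s))).trans_lt hlt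
  choose p hp using hparent
  obtain ⟨γ, hγ₀, hγ⟩ := exists_eq_mul_parent s₀ d (fun s => (p s).1) (fun s => (p s).2)
    fun s hs => (hp s hs).elim fun _ h => h.1
  refine ⟨⟨T, γ, d, hγ₀, fun s hs => ?_⟩⟩
  obtain ⟨j, hlt, hps⟩ := hp s hs
  have hγs := hγ s hs
  rw [hps] at hlt hγs
  exact ⟨j, hlt, hγs⟩

namespace SchreierTransversal

variable {s₀ : S} (T : SchreierTransversal H s₀)

theorem induction {P : S → Prop} (base : P s₀)
    (step : ∀ j s, T.rep s = (T.orbit j).transporter s * T.rep ((T.orbit j).base ⟦s⟧) →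
      P ((T.orbit j).base ⟦s⟧) → P s) (s : S) : P s := by
  induction hn : T.depth s using Nat.strong_induction_on generalizing s with
  | _ n ih =>
    by_cases hs : s = s₀
    · exact hs ▸ base
    · obtain ⟨j, hlt, hrep⟩ := T.exists_parent s hs
      exact step j s hrep (ih _ (hn ▸ hlt) _ rfl)

theorem rep_smul (s : S) : T.rep s • s₀ = s := by
  induction s using T.induction with
  | base => rw [T.rep_self, one_smul]
  | step j s hrep ih =>
    rw [hrep, mul_smul, ih]
    exact (T.orbit j).transporter_smul_base s

theorem inv_rep_mul_mul_rep_mem {x : F} {s t : S} (hx : x • s = t) :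
    (T.rep t)⁻¹ * x * T.rep s ∈ stabilizer F s₀ := by
  rw [mem_stabilizer_iff, mul_smul, mul_smul, T.rep_smul, hx, inv_smul_eq_iff, T.rep_smul]

/-- The element of the stabilizer obtained by closing up the edge from the base point of the
`H j`-orbit of `s` to `s` with the paths in the tree. -/
def edge (p : J × S) : stabilizer F s₀ :=
  ⟨_, T.inv_rep_mul_mul_rep_mem ((T.orbit p.1).transporter_smul_base p.2)⟩

/-- The vertex groups of the Kurosh decomposition, before conjugation. -/
abbrev vertexGroup (i : OrbitIndex H S) : Subgroup (H i.1) :=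
  stabilizer (H i.1) ((T.orbit i.1).base i.2)

/-- The abstract Kurosh decomposition: the free product of the vertex groups with the free group
on the edges outside the tree. -/
abbrev FreeProduct : Type _ :=
  Coprod (CoprodI fun i => T.vertexGroup i) (FreeGroup {p // T.edge p ≠ 1})

/-- The embedding of a vertex group in the stabilizer by conjugation. -/
def vertexHom (i : OrbitIndex H S) : T.vertexGroup i →* stabilizer F s₀ :=
  MonoidHom.mk' (fun x => ⟨_, T.inv_rep_mul_mul_rep_mem (x := ((x : H i.1) : F)) x.2⟩)
    fun x y => by
      ext
      simp only [Subgroup.coe_mul]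
      group

/-- The canonical homomorphism from the abstract Kurosh decomposition to the stabilizer. -/
def toStabilizer : T.FreeProduct →* stabilizer F s₀ :=
  Coprod.lift (CoprodI.lift T.vertexHom) (FreeGroup.lift fun p => T.edge p)

/-- The inclusion of a vertex group in the abstract Kurosh decomposition. -/
def ofVertex (i : OrbitIndex H S) : T.vertexGroup i →* T.FreeProduct :=
  Coprod.inl.comp (CoprodI.of (M := fun i => T.vertexGroup i))

open Classical in
/-- The generator of an edge in the abstract Kurosh decomposition, trivial for edges of the
tree. -/
noncomputable def ofEdge (p : J × S) : T.FreeProduct :=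
  if hp : T.edge p = 1 then 1 else Coprod.inr (FreeGroup.of ⟨p, hp⟩)

theorem toStabilizer_ofVertex {i : OrbitIndex H S} (x : T.vertexGroup i) :
    T.toStabilizer (T.ofVertex i x) = T.vertexHom i x := by
  simp [toStabilizer, ofVertex]

theorem toStabilizer_ofEdge (p : J × S) : T.toStabilizer (T.ofEdge p) = T.edge p := by
  rw [ofEdge]
  split_ifs with hp
  · rw [map_one, hp]
  · simp [toStabilizer]

theorem edge_base (j : J) (ω : orbitRel.Quotient (H j) S) :
    T.edge (j, (T.orbit j).base ω) = 1 := by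
  ext
  simp [edge, OrbitTransversal.transporter_base]

theorem edge_eq_one {j : J} {s : S}
    (h : T.rep s = (T.orbit j).transporter s * T.rep ((T.orbit j).base ⟦s⟧)) :
    T.edge (j, s) = 1 := by
  ext
  simp [edge, h, mul_assoc]

theorem exists_isCocycle (hH : IsInternalFreeProduct H) :
    ∃ Θ : F → S → T.FreeProduct, IsCocycle Θ ∧
      (∀ j s, Θ ((T.orbit j).transporter s) ((T.orbit j).base ⟦s⟧) = T.ofEdge (j, s)) ∧
      ∀ i (x : T.vertexGroup i), Θ (x : H i.1) ((T.orbit i.1).base i.2) = T.ofVertex i x := by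
  choose θ hθ hedge hvertex using fun j =>
    (T.orbit j).exists_isCocycle (fun ω => T.ofVertex ⟨j, ω⟩) (fun s => T.ofEdge (j, s))
      fun ω => dif_pos (T.edge_base j ω)
  obtain ⟨Θ, hΘ, hΘθ⟩ := hH.exists_isCocycle hθ
  exact ⟨Θ, hΘ, fun j s => by rw [hΘθ, hedge], fun i x => by rw [hΘθ, hvertex]⟩

variable {Θ : F → S → T.FreeProduct}

theorem toStabilizer_cocycle (hH : ⨆ j, H j = ⊤) (hΘ : IsCocycle Θ)
    (hedge : ∀ j s, Θ ((T.orbit j).transporter s) ((T.orbit j).base ⟦s⟧) = T.ofEdge (j, s))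
    (hvertex : ∀ i (x : T.vertexGroup i),
      Θ (x : H i.1) ((T.orbit i.1).base i.2) = T.ofVertex i x) (x : F) (s : S) :
    (T.toStabilizer (Θ x s) : F) = (T.rep (x • s))⁻¹ * x * T.rep s := by
  have hπΘ := hΘ.comp_hom ((stabilizer F s₀).subtype.comp T.toStabilizer)
  refine congrFun₂ (hπΘ.eq_of_eqOn_of_iSup_eq_top (isCocycle_inv_mul_mul T.rep) hH
    fun j x hx => ?_) x s
  refine congrFun ((T.orbit j).isCocycle_eq (hπΘ.restrict (H j))
    ((isCocycle_inv_mul_mul T.rep).restrict (H j)) (fun s => ?_) fun ω y hy => ?_) ⟨x, hx⟩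
  · have hs : ((T.orbit j).transporter s : F) • (T.orbit j).base ⟦s⟧ = s :=
      (T.orbit j).transporter_smul_base s
    simp [hedge, toStabilizer_ofEdge, hs, edge]
  · have hy' : (y : F) • (T.orbit j).base ω = (T.orbit j).base ω := hy
    have hyΘ : Θ y ((T.orbit j).base ω) = T.ofVertex ⟨j, ω⟩ ⟨y, hy⟩ := hvertex ⟨j, ω⟩ ⟨y, hy⟩
    simp [hyΘ, toStabilizer_ofVertex, hy', vertexHom]

theorem cocycle_rep (hΘ : IsCocycle Θ)
    (hedge : ∀ j s, Θ ((T.orbit j).transporter s) ((T.orbit j).base ⟦s⟧) = T.ofEdge (j, s))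
    (s : S) : Θ (T.rep s) s₀ = 1 := by
  induction s using T.induction with
  | base => rw [T.rep_self, hΘ.one_apply]
  | step j s hrep ih =>
    rw [hrep, hΘ, T.rep_smul, ih, hedge, mul_one]
    exact dif_pos (T.edge_eq_one hrep)

theorem bijective_toStabilizer (hH : IsInternalFreeProduct H) :
    Function.Bijective T.toStabilizer := by
  obtain ⟨Θ, hΘ, hedge, hvertex⟩ := T.exists_isCocycle hH
  have hconj {x : F} {s t : S} (hx : x • s = t) :
      Θ ((T.rep t)⁻¹ * x * T.rep s) s₀ = Θ x s := by
    rw [hΘ.inv_mul_mul_apply ((T.rep_smul t).trans hx.symm) (T.rep_smul s),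
      T.cocycle_rep hΘ hedge, T.cocycle_rep hΘ hedge, inv_one, one_mul, mul_one]
  refine bijective_of_comp_eq_id (g := hΘ.stabilizerHom s₀)
    (Coprod.hom_ext (CoprodI.ext_hom _ _ fun i => MonoidHom.ext fun x => ?_)
      (FreeGroup.ext_hom _ _ fun p => ?_)) (MonoidHom.ext fun x => Subtype.ext ?_)
  · exact (congrArg (hΘ.stabilizerHom s₀) (T.toStabilizer_ofVertex x)).trans
      ((hconj x.2).trans (hvertex i x))
  · have hp : T.ofEdge p = Coprod.inr (FreeGroup.of p) := dif_neg p.2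
    simp only [MonoidHom.comp_apply, MonoidHom.id_apply, ← hp, T.toStabilizer_ofEdge]
    exact (hconj ((T.orbit _).transporter_smul_base _)).trans (hedge _ _)
  · refine (T.toStabilizer_cocycle hH.iSup_eq_top hΘ hedge hvertex x s₀).trans ?_
    rw [x.2, T.rep_self, inv_one, one_mul, mul_one]
    rfl

theorem isFreeFactorFamily_range_vertexHom (hH : IsInternalFreeProduct H) :
    IsFreeFactorFamily fun i => (T.vertexHom i).range :=
  isFreeFactorFamily_range (T.bijective_toStabilizer hH)

theorem exists_eq_mul_inv_rep_base_mul (j : J) (x : F) :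
    ∃ ω, ∃ k ∈ stabilizer F s₀, ∃ h ∈ H j, x = k * (T.rep ((T.orbit j).base ω))⁻¹ * h := by
  let t : H j := (T.orbit j).transporter (x⁻¹ • s₀)
  refine ⟨⟦x⁻¹ • s₀⟧, x * t * T.rep ((T.orbit j).base ⟦x⁻¹ • s₀⟧), ?_, t⁻¹, inv_mem t.2, by group⟩
  have ht : (t : F) • (T.orbit j).base ⟦x⁻¹ • s₀⟧ = x⁻¹ • s₀ :=
    (T.orbit j).transporter_smul_base _
  rw [mem_stabilizer_iff, mul_smul, mul_smul, T.rep_smul, ht, smul_inv_smul]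

end SchreierTransversal

end Kurosh

section KuroshFamily

open MulAction

theorem mem_map_conj_iff {G : Type*} [Group G] {H : Subgroup G} {x g : G} :
    g ∈ H.map (MulAut.conj x).toMonoidHom ↔ x⁻¹ * g * x ∈ H := by
  refine Subgroup.mem_map_equiv.trans ?_
  rw [MulAut.conj_symm_apply]

theorem SchreierTransversal.mem_range_vertexHom {F S J : Type*} [Group F] [MulAction F S]
    {H : J → Subgroup F} {s₀ : S} (T : SchreierTransversal H s₀)
    {i : OrbitIndex H S} {k : stabilizer F s₀} :
    k ∈ (T.vertexHom i).range ↔ (k : F) ∈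
      (H i.1).map (MulAut.conj (T.rep ((T.orbit i.1).base i.2))⁻¹).toMonoidHom := by
  let γ := T.rep ((T.orbit i.1).base i.2)
  have hγ : γ • s₀ = (T.orbit i.1).base i.2 := T.rep_smul _
  have hk : (k : F) • s₀ = s₀ := k.2
  rw [mem_map_conj_iff, inv_inv]
  constructor
  · rintro ⟨x, rfl⟩
    simp [vertexHom, mul_assoc]
  · intro hmem
    have hfix : (γ * k * γ⁻¹) • (T.orbit i.1).base i.2 = (T.orbit i.1).base i.2 := by
      rw [← hγ, mul_smul, mul_smul, inv_smul_smul, hk]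
    refine ⟨⟨⟨_, hmem⟩, hfix⟩, Subtype.ext ?_⟩
    simp [vertexHom, mul_assoc]

variable {G K ι : Type*} [Group G] [Group K]

theorem IsFreeFactorFamily.comap_mulEquiv {H : ι → Subgroup G} (hH : IsFreeFactorFamily H)
    (e : K ≃* G) : IsFreeFactorFamily fun i => (H i).comap e.toMonoidHom := by
  obtain ⟨B, hB⟩ := hH
  have he : Coprod.lift (CoprodI.lift fun i => e.symm.toMonoidHom.comp (H i).subtype)
      (e.symm.toMonoidHom.comp B.subtype) =
        e.symm.toMonoidHom.comp (Coprod.lift (CoprodI.lift fun i => (H i).subtype) B.subtype) :=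
    Coprod.hom_ext (CoprodI.ext_hom _ _ fun i => by ext; simp) (by ext; simp)
  have hbij : Function.Bijective
      (Coprod.lift (CoprodI.lift fun i => e.symm.toMonoidHom.comp (H i).subtype)
        (e.symm.toMonoidHom.comp B.subtype)) := by
    rw [he]
    exact e.symm.bijective.comp hB
  simpa only [MonoidHom.range_comp, Subgroup.range_subtype, Subgroup.comap_equiv_eq_map_symm']
    using isFreeFactorFamily_range hbij

/-- The Kurosh subgroup theorem. Here `R k` represents the double cosets in `φ(K) \ G / B k`. -/
theorem IsFreeFactorFamily.exists_comap_conj {B : ι → Subgroup G} (hB : IsFreeFactorFamily B)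
    {φ : K →* G} (hφ : Function.Injective φ) :
    ∃ R : ι → Set G,
      (IsFreeFactorFamily fun i : Σ k, R k =>
        ((B i.1).map (MulAut.conj (i.2 : G)).toMonoidHom).comap φ) ∧
      ∀ k x, ∃ r ∈ R k, ∃ a : K, ∃ b ∈ B k, x = φ a * r * b := by
  obtain ⟨C, hC⟩ := isFreeFactorFamily_iff_exists_isInternalFreeProduct.1 hB
  let s₀ : G ⧸ φ.range := (1 : G)
  have hstab : stabilizer G s₀ = φ.range := stabilizer_quotient _
  let e : K ≃* stabilizer G s₀ :=
    (MonoidHom.ofInjective hφ).trans (MulEquiv.subgroupCongr hstab.symm)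
  obtain ⟨T⟩ := nonempty_schreierTransversal hC.iSup_eq_top s₀
  let γ (o : Option ι) (ω) : G := (T.rep ((T.orbit o).base ω))⁻¹
  refine ⟨fun k => Set.range (γ (some k)), ?_, fun k x => ?_⟩
  · let f : (Σ k, Set.range (γ (some k))) →
        OrbitIndex (fun o : Option ι => o.elim C B) (G ⧸ φ.range) :=
      Sigma.map some fun k => Set.rangeSplitting (γ (some k))
    have hf : Function.Injective f := (Option.some_injective ι).sigma_map fun k =>
      Set.rangeSplitting_injective (γ (some k))
    convert ((T.isFreeFactorFamily_range_vertexHom hC).comap_mulEquiv e).comp_injective hf using 2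
      with i
    ext a
    refine Iff.trans ?_ T.mem_range_vertexHom.symm
    rw [← Set.apply_rangeSplitting _ i.2]
    rfl
  · obtain ⟨ω, y, hy, b, hb, rfl⟩ := T.exists_eq_mul_inv_rep_base_mul (some k) x
    obtain ⟨a, rfl⟩ := hstab ▸ hy
    exact ⟨_, ⟨ω, rfl⟩, a, b, hb, rfl⟩

end KuroshFamily

section Rank

open IsFreeGroup

theorem nonempty_equiv_generators {G X : Type*} [Group G] [IsFreeGroup G]
    (b : FreeGroupBasis X G) : Nonempty (X ≃ Generators G) :=
  ⟨.ofFreeGroupEquiv (b.repr.symm.trans (basis G).repr)⟩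

theorem freeGroupRank_congr {G G' : Type*} [Group G] [Group G'] [IsFreeGroup G] [IsFreeGroup G']
    (e : G ≃* G') : freeGroupRank G = freeGroupRank G' :=
  Nat.card_congr (Equiv.ofIsFreeGroupEquiv e)

variable {G ι : Type*} [Group G] [IsFreeGroup G]

theorem nonempty_generators_iff : Nonempty (Generators G) ↔ Nontrivial G := by
  rw [← not_iff_not, not_nonempty_iff, not_nontrivial_iff_subsingleton]
  constructor
  · intro _
    exact (toFreeGroup G).toEquiv.subsingleton
  · intro _
    exact ⟨fun a => FreeGroup.of_ne_one a ((mulEquiv G).injective (Subsingleton.elim _ _))⟩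

theorem freeGroupRank_pos_iff [Finite (Generators G)] : 0 < freeGroupRank G ↔ Nontrivial G := by
  rw [freeGroupRank, Finite.card_pos_iff, nonempty_generators_iff]

theorem freeGroupRank_of_subsingleton [Subsingleton G] : freeGroupRank G = 0 := by
  have : IsEmpty (Generators G) :=
    not_nonempty_iff.1 (nonempty_generators_iff.not.2 (not_nontrivial G))
  exact Nat.card_of_isEmpty

variable {H : ι → Subgroup G}

theorem IsInternalFreeProduct.nonempty_sigma_generators_equiv (hH : IsInternalFreeProduct H) :
    Nonempty ((Σ i, Generators (H i)) ≃ Generators G) :=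
  nonempty_equiv_generators
    ((CoprodI.FreeGroupBasis.coprodI fun i => basis (H i)).map (MulEquiv.ofBijective _ hH))

theorem IsInternalFreeProduct.finite_generators [Finite (Generators G)]
    (hH : IsInternalFreeProduct H) (i : ι) : Finite (Generators (H i)) := by
  obtain ⟨e⟩ := hH.nonempty_sigma_generators_equiv
  exact Finite.of_injective (fun x => e ⟨i, x⟩) (e.injective.comp sigma_mk_injective)

theorem IsInternalFreeProduct.freeGroupRank_eq_sum [Fintype ι] [Finite (Generators G)]
    (hH : IsInternalFreeProduct H) : freeGroupRank G = ∑ i, freeGroupRank (H i) := by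
  obtain ⟨e⟩ := hH.nonempty_sigma_generators_equiv
  have := hH.finite_generators
  rw [freeGroupRank, ← Nat.card_congr e, Nat.card_sigma]
  rfl

namespace IsFreeFactorFamily

variable [Finite (Generators G)]

theorem finite_generators (hH : IsFreeFactorFamily H) (i : ι) : Finite (Generators (H i)) := by
  obtain ⟨B, hB⟩ := isFreeFactorFamily_iff_exists_isInternalFreeProduct.1 hH
  exact hB.finite_generators (some i)

theorem finite_of_ne_bot (hH : IsFreeFactorFamily H) (hne : ∀ i, H i ≠ ⊥) : Finite ι := by
  obtain ⟨B, hB⟩ := isFreeFactorFamily_iff_exists_isInternalFreeProduct.1 hH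
  obtain ⟨e⟩ := hB.nonempty_sigma_generators_equiv
  have hgen (i : ι) : Nonempty (Generators (H i)) :=
    nonempty_generators_iff.2 ((Subgroup.nontrivial_iff_ne_bot (H i)).2 (hne i))
  refine Finite.of_injective (fun i => e ⟨some i, (hgen i).some⟩) fun i j hij => ?_
  exact Option.some_injective ι (congrArg Sigma.fst (e.injective hij))

theorem freeGroupRank_pos (hH : IsFreeFactorFamily H) {i : ι} (hi : H i ≠ ⊥) :
    0 < freeGroupRank (H i) := by
  have := hH.finite_generators i
  exact freeGroupRank_pos_iff.2 ((Subgroup.nontrivial_iff_ne_bot (H i)).2 hi)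

variable [Fintype ι]

theorem sum_freeGroupRank_le (hH : IsFreeFactorFamily H) :
    ∑ i, freeGroupRank (H i) ≤ freeGroupRank G := by
  obtain ⟨B, hB⟩ := isFreeFactorFamily_iff_exists_isInternalFreeProduct.1 hH
  rw [hB.freeGroupRank_eq_sum, Fintype.sum_option]
  exact Nat.le_add_left _ _

theorem iSup_eq_top_of_freeGroupRank_le (hH : IsFreeFactorFamily H)
    (hrank : freeGroupRank G ≤ ∑ i, freeGroupRank (H i)) : ⨆ i, H i = ⊤ := by
  obtain ⟨B, hB⟩ := isFreeFactorFamily_iff_exists_isInternalFreeProduct.1 hH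
  have hbot : B = ⊥ := by
    by_contra hne
    have : Finite (Generators B) := hB.finite_generators none
    have hpos : 0 < freeGroupRank B :=
      freeGroupRank_pos_iff.2 ((Subgroup.nontrivial_iff_ne_bot B).2 hne)
    rw [hB.freeGroupRank_eq_sum, Fintype.sum_option] at hrank
    simp only [Option.elim_none, Option.elim_some] at hrank
    lia
  simpa only [iSup_option_elim, hbot, bot_sup_eq] using hB.iSup_eq_top

end IsFreeFactorFamily

end Rank

section Subconjugate

variable {G G' : Type*} [Group G] [Group G'] {H K L : Subgroup G}

/-- `H` is conjugate in `G` to a subgroup of `K`. This is the relation between components in the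
definition of `Carries`. -/
def IsSubconjugate (H K : Subgroup G) : Prop :=
  ∃ x : G, H ≤ K.map (MulAut.conj x).toMonoidHom

theorem isSubconjugate_of_le (h : H ≤ K) : IsSubconjugate H K :=
  ⟨1, fun g hg => mem_map_conj_iff.2 (by simpa using h hg)⟩

theorem IsSubconjugate.trans (h : IsSubconjugate H K) (h' : IsSubconjugate K L) :
    IsSubconjugate H L := by
  obtain ⟨x, hx⟩ := h
  obtain ⟨y, hy⟩ := h'
  refine ⟨x * y, fun g hg => mem_map_conj_iff.2 ?_⟩
  simpa only [mul_inv_rev, mul_assoc] using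
    mem_map_conj_iff.1 (hy (mem_map_conj_iff.1 (hx hg)))

theorem IsSubconjugate.map (f : G →* G') (h : IsSubconjugate H K) :
    IsSubconjugate (H.map f) (K.map f) := by
  obtain ⟨x, hx⟩ := h
  refine ⟨f x, ?_⟩
  rintro _ ⟨g, hg, rfl⟩
  exact mem_map_conj_iff.2 ⟨x⁻¹ * g * x, mem_map_conj_iff.1 (hx hg), by simp⟩

theorem IsFreeFactorFamily.exists_conj_subgroupOf {ι : Type*} {B : ι → Subgroup G}
    (hB : IsFreeFactorFamily B) (hBH : ∀ k, IsSubconjugate (B k) H) :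
    ∃ y : ι → G, (∀ k, (B k).map (MulAut.conj (y k)).toMonoidHom ≤ H) ∧
      IsFreeFactorFamily fun k => ((B k).map (MulAut.conj (y k)).toMonoidHom).subgroupOf H := by
  obtain ⟨R, hfamily, hcover⟩ := hB.exists_comap_conj H.subtype_injective
  choose x hx using hBH
  choose r hrR a b hb hxr using fun k => hcover k (x k)⁻¹
  refine ⟨r, fun k g hg => ?_, hfamily.comp_injective
    (e := fun k => ⟨k, r k, hrR k⟩) fun k l hkl => congrArg Sigma.fst hkl⟩
  have hgB : (b k)⁻¹ * ((r k)⁻¹ * g * r k) * b k ∈ B k :=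
    mul_mem (mul_mem (inv_mem (hb k)) (mem_map_conj_iff.1 hg)) (hb k)
  have hgH : a k * g * (a k)⁻¹ ∈ H := by
    have := mem_map_conj_iff.1 (hx k hgB)
    rw [← inv_inv (x k), inv_inv (x k)⁻¹, hxr] at this
    simpa [mul_assoc] using this
  simpa [mul_assoc] using mul_mem (mul_mem (inv_mem (a k).2) hgH) (a k).2

end Subconjugate

section Complexity

variable {G ι κ : Type*} [Group G] [IsFreeGroup G]

theorem freeGroupRank_conj_subgroupOf {B H : Subgroup G} {y : G}
    (h : B.map (MulAut.conj y).toMonoidHom ≤ H) :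
    freeGroupRank ((B.map (MulAut.conj y).toMonoidHom).subgroupOf H) = freeGroupRank B :=
  freeGroupRank_congr ((Subgroup.subgroupOfEquivOfLe h).trans
    (B.equivMapOfInjective _ (MulAut.conj y).injective).symm)

namespace IsFreeFactorFamily

theorem sum_freeGroupRank_le_of_isSubconjugate [Fintype κ] {B : κ → Subgroup G}
    (hB : IsFreeFactorFamily B) {H : Subgroup G} [Finite (IsFreeGroup.Generators H)]
    (hBH : ∀ k, IsSubconjugate (B k) H) : ∑ k, freeGroupRank (B k) ≤ freeGroupRank H := by
  obtain ⟨y, hy, hfamily⟩ := hB.exists_conj_subgroupOf hBH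
  simpa only [freeGroupRank_conj_subgroupOf (hy _)] using hfamily.sum_freeGroupRank_le

theorem isSubconjugate_of_freeGroupRank_le {B : κ → Subgroup G} (hB : IsFreeFactorFamily B)
    {H : Subgroup G} [Finite (IsFreeGroup.Generators H)] {k : κ} (hBH : IsSubconjugate (B k) H)
    (hrank : freeGroupRank H ≤ freeGroupRank (B k)) : IsSubconjugate H (B k) := by
  have hk : IsFreeFactorFamily fun _ : Unit => B k :=
    hB.comp_injective (Function.injective_of_subsingleton fun _ => k)
  obtain ⟨y, hy, hfamily⟩ := hk.exists_conj_subgroupOf fun _ => hBH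
  have htop := hfamily.iSup_eq_top_of_freeGroupRank_le
    (by simpa only [Fintype.sum_unique, freeGroupRank_conj_subgroupOf (hy _)] using hrank)
  exact ⟨y (), Subgroup.subgroupOf_eq_top.1 (ciSup_unique.symm.trans htop)⟩

variable [Finite (IsFreeGroup.Generators G)]

theorem complexity_lt_or_isSubconjugate [Fintype κ] {B : κ → Subgroup G}
    (hB : IsFreeFactorFamily B) (hB_ne : ∀ k, B k ≠ ⊥) {H : Subgroup G}
    [Finite (IsFreeGroup.Generators H)] (hH_ne : H ≠ ⊥) (hBH : ∀ k, IsSubconjugate (B k) H) :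
    ∑ k, (2 * freeGroupRank (B k) - 1) < 2 * freeGroupRank H - 1 ∨
      (∑ k, (2 * freeGroupRank (B k) - 1) = 2 * freeGroupRank H - 1 ∧
        ∃ k, IsSubconjugate H (B k)) := by
  have hpos : 0 < freeGroupRank H :=
    freeGroupRank_pos_iff.2 ((Subgroup.nontrivial_iff_ne_bot H).2 hH_ne)
  have hle := hB.sum_freeGroupRank_le_of_isSubconjugate hBH
  have hsum : ∑ k, (2 * freeGroupRank (B k) - 1) + Fintype.card κ =
      2 * ∑ k, freeGroupRank (B k) := by
    rw [Finset.mul_sum, Fintype.card_eq_sum_ones, ← Finset.sum_add_distrib]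
    refine Finset.sum_congr rfl fun k _ => ?_
    have := hB.freeGroupRank_pos (hB_ne k)
    lia
  by_cases heq : Fintype.card κ = 1 ∧ freeGroupRank H ≤ ∑ k, freeGroupRank (B k)
  · obtain ⟨k, hk⟩ := Fintype.card_eq_one_iff.1 heq.1
    have hk_sum : ∑ l, freeGroupRank (B l) = freeGroupRank (B k) :=
      Fintype.sum_eq_single k fun l hl => absurd (hk l) hl
    exact Or.inr ⟨by lia, k, hB.isSubconjugate_of_freeGroupRank_le (hBH k) (hk_sum ▸ heq.2)⟩
  · left
    rcases isEmpty_or_nonempty κ with _ | _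
    · rw [Fintype.sum_empty]
      lia
    · have := Fintype.card_pos (α := κ)
      lia

theorem sum_complexity_lt_or_isSubconjugate [Fintype ι] [Fintype κ] {H : ι → Subgroup G}
    (hH : IsFreeFactorFamily H) (hH_ne : ∀ i, H i ≠ ⊥) {B : κ → Subgroup G}
    (hB : IsFreeFactorFamily B) (hB_ne : ∀ k, B k ≠ ⊥)
    (hBH : ∀ k, ∃ i, IsSubconjugate (B k) (H i)) :
    ∑ k, (2 * freeGroupRank (B k) - 1) < ∑ i, (2 * freeGroupRank (H i) - 1) ∨
      ∀ i, ∃ k, IsSubconjugate (H i) (B k) := by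
  classical
  choose f hf using hBH
  have hfiber (i : ι) := by
    have := hH.finite_generators i
    have hBi : IsFreeFactorFamily fun k : {k // f k = i} => B k :=
      hB.comp_injective Subtype.val_injective
    exact hBi.complexity_lt_or_isSubconjugate (fun k => hB_ne k) (hH_ne i)
      (by rintro ⟨k, rfl⟩; exact hf k)
  rw [← Fintype.sum_fiberwise f fun k => 2 * freeGroupRank (B k) - 1]
  by_cases hall : ∀ i, ∃ k, IsSubconjugate (H i) (B k)
  · exact Or.inr hall
  · obtain ⟨i, hi⟩ := not_forall.1 hall
    refine Or.inl (Finset.sum_lt_sum (fun j _ => (hfiber j).elim le_of_lt fun h => h.1.le)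
      ⟨i, Finset.mem_univ i, (hfiber i).resolve_right fun h => hi ?_⟩)
    exact h.2.imp' _ fun _ => id

end IsFreeFactorFamily

end Complexity

section Systems

variable {G G' : Type*} [Group G] [Group G'] {𝒜 ℬ 𝒞 𝓕 𝓖 : Set (Subgroup G)}

theorem carries_singleton_top : Carries {⊤} 𝒜 := fun _ _ =>
  ⟨⊤, rfl, isSubconjugate_of_le le_top⟩

theorem carries_singleton_bot (h : 𝒜.Nonempty) : Carries 𝒜 {⊥} := by
  obtain ⟨A, hA⟩ := h
  rintro _ rfl
  exact ⟨A, hA, isSubconjugate_of_le bot_le⟩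

theorem carries_of_subset (h : ℬ ⊆ 𝒜) : Carries 𝒜 ℬ := fun B hB =>
  ⟨B, h hB, isSubconjugate_of_le le_rfl⟩

theorem Carries.trans (h : Carries 𝒜 ℬ) (h' : Carries ℬ 𝒞) : Carries 𝒜 𝒞 := by
  intro C hC
  obtain ⟨B, hB, hCB⟩ := h' C hC
  obtain ⟨A, hA, hBA⟩ := h B hB
  exact ⟨A, hA, IsSubconjugate.trans hCB hBA⟩

theorem Carries.map (f : G →* G') (h : Carries 𝒜 ℬ) :
    Carries ((fun H : Subgroup G => H.map f) '' 𝒜) ((fun H : Subgroup G => H.map f) '' ℬ) := by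
  rintro _ ⟨B, hB, rfl⟩
  obtain ⟨A, hA, hBA⟩ := h B hB
  exact ⟨_, ⟨A, hA, rfl⟩, IsSubconjugate.map f hBA⟩

theorem CarriesClass.map (f : G →* G') {g : G} (h : CarriesClass 𝒜 (ConjClasses.mk g)) :
    CarriesClass ((fun H : Subgroup G => H.map f) '' 𝒜) (ConjClasses.mk (f g)) := by
  obtain ⟨A, hA, a, ha, hag⟩ := h
  exact ⟨_, ⟨A, hA, rfl⟩, f a, ⟨a, ha, rfl⟩, congrArg (ConjClasses.map f) hag⟩

theorem carriesClass_mk_iff {g : G} :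
    CarriesClass 𝒜 (ConjClasses.mk g) ↔ Carries 𝒜 {Subgroup.zpowers g} := by
  simp only [CarriesClass, Carries, Set.mem_singleton_iff, forall_eq, Subgroup.zpowers_le,
    ConjClasses.mk_eq_mk_iff_isConj, isConj_iff]
  refine exists_congr fun A => and_congr_right fun _ => ⟨?_, ?_⟩
  · rintro ⟨a, ha, x, hx⟩
    exact ⟨x, a, ha, hx⟩
  · rintro ⟨x, a, ha, hx⟩
    exact ⟨a, ha, x, hx⟩

theorem IsFreeFactorSystem.nonempty (h𝓕 : IsFreeFactorSystem 𝓕) : 𝓕.Nonempty :=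
  h𝓕.elim (fun h => h ▸ Set.singleton_nonempty ⊥) fun h => h.1

section Families

variable {ι : Type*} {P : ι → Subgroup G}

theorem IsFreeFactorFamily.isFreeFactorSystem_range [Finite ι] [Nonempty ι]
    (hP : IsFreeFactorFamily P) (hP_ne : ∀ i, P i ≠ ⊥) : IsFreeFactorSystem (Set.range P) := by
  refine Or.inr ⟨Set.range_nonempty P, Set.finite_range P, Set.forall_mem_range.2 hP_ne, ?_⟩
  have hrange : IsFreeFactorFamily fun H : Set.range P => (H : Subgroup G) := by
    simpa only [Set.apply_rangeSplitting] using hP.comp_injective (Set.rangeSplitting_injective P)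
  exact hrange

theorem isFreeFactorSystem_singleton_top [Nontrivial G] :
    IsFreeFactorSystem ({⊤} : Set (Subgroup G)) := by
  simpa only [Set.range_const] using
    isFreeFactorFamily_top.isFreeFactorSystem_range fun _ => top_ne_bot

theorem IsFreeFactorFamily.exists_isFreeFactorSystem_carries_range [IsFreeGroup G]
    [Finite (IsFreeGroup.Generators G)] [Nonempty ι] (hP : IsFreeFactorFamily P) :
    ∃ 𝓖, IsFreeFactorSystem 𝓖 ∧ Carries 𝓖 (Set.range P) ∧ Carries (Set.range P) 𝓖 := by
  by_cases htriv : ∀ i, P i = ⊥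
  · have hrange : Set.range P = {⊥} := by
      rw [funext htriv, Set.range_const]
    exact ⟨{⊥}, Or.inl rfl, carries_of_subset hrange.le, carries_of_subset hrange.ge⟩
  · have hnontriv : Nonempty {i // P i ≠ ⊥} := nonempty_subtype.2 (not_forall.1 htriv)
    have hQ : IsFreeFactorFamily fun i : {i // P i ≠ ⊥} => P i :=
      hP.comp_injective Subtype.val_injective
    have := hQ.finite_of_ne_bot fun i => i.2
    refine ⟨_, hQ.isFreeFactorSystem_range fun i => i.2, ?_, ?_⟩
    · rintro _ ⟨i, rfl⟩
      by_cases hi : P i = ⊥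
      · exact ⟨_, ⟨hnontriv.some, rfl⟩, isSubconjugate_of_le (hi.trans_le bot_le)⟩
      · exact ⟨_, ⟨⟨i, hi⟩, rfl⟩, isSubconjugate_of_le le_rfl⟩
    · exact carries_of_subset (Set.range_comp_subset_range Subtype.val P)

end Families

variable [IsFreeGroup G]

/-- The complexity of a finite system of free factors, which strictly decreases along the preorder
of free factor systems modulo equivalence. The trivial system has complexity `0`. -/
noncomputable def systemComplexity (𝓕 : Set (Subgroup G)) : ℕ :=
  ∑ᶠ H : 𝓕, (2 * freeGroupRank (H : Subgroup G) - 1)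

theorem systemComplexity_singleton (H : Subgroup G) :
    systemComplexity {H} = 2 * freeGroupRank H - 1 := by
  rw [systemComplexity, finsum_eq_sum_of_fintype, Fintype.sum_unique, Set.default_coe_singleton]

variable [Finite (IsFreeGroup.Generators G)]

theorem IsFreeFactorSystem.complexity_lt_or_carries (h𝓕 : IsFreeFactorSystem 𝓕)
    (h𝓖 : IsFreeFactorSystem 𝓖) (h : Carries 𝓕 𝓖) :
    systemComplexity 𝓖 < systemComplexity 𝓕 ∨ Carries 𝓖 𝓕 := by
  obtain rfl | ⟨h𝓕_nonempty, h𝓕_fin, h𝓕_ne, h𝓕_fam⟩ := h𝓕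
  · exact Or.inr (carries_singleton_bot h𝓖.nonempty)
  have := h𝓕_nonempty.to_subtype
  have := h𝓕_fin.fintype
  replace h𝓕_fam : IsFreeFactorFamily fun H : 𝓕 => (H : Subgroup G) := h𝓕_fam
  obtain rfl | ⟨-, h𝓖_fin, h𝓖_ne, h𝓖_fam⟩ := h𝓖
  · left
    rw [systemComplexity_singleton, freeGroupRank_of_subsingleton, systemComplexity,
      finsum_eq_sum_of_fintype]
    refine Finset.sum_pos (fun H _ => ?_) Finset.univ_nonempty
    have := h𝓕_fam.freeGroupRank_pos (h𝓕_ne H H.2)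
    lia
  · have := h𝓖_fin.fintype
    have hdrop := h𝓕_fam.sum_complexity_lt_or_isSubconjugate (fun H => h𝓕_ne H H.2)
      (B := fun H : 𝓖 => (H : Subgroup G)) h𝓖_fam (fun H => h𝓖_ne H H.2) fun B =>
        (h B B.2).elim fun H hH => ⟨⟨H, hH.1⟩, hH.2⟩
    rw [systemComplexity, systemComplexity, finsum_eq_sum_of_fintype, finsum_eq_sum_of_fintype]
    exact hdrop.imp_right fun h' H hH => (h' ⟨H, hH⟩).elim fun B hB => ⟨B, B.2, hB⟩

end Systems

section Pullback

variable {F K ι : Type*} [Group F] [Group K]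

/-- `𝓖` is the pullback along `φ` of the system `𝓕` of subgroups of `F`: it carries exactly the
systems whose image under `φ` is carried by `𝓕`. This determines `𝓖` up to equivalence. -/
def IsPullback (φ : K →* F) (𝓕 : Set (Subgroup F)) (𝓖 : Set (Subgroup K)) : Prop :=
  ∀ ℬ : Set (Subgroup K), Carries 𝓖 ℬ ↔ Carries 𝓕 ((fun H : Subgroup K => H.map φ) '' ℬ)

theorem IsPullback.carriesClass_iff {φ : K →* F} {𝓕 : Set (Subgroup F)} {𝓖 : Set (Subgroup K)}
    (h : IsPullback φ 𝓕 𝓖) {a : K} :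
    CarriesClass 𝓖 (ConjClasses.mk a) ↔ CarriesClass 𝓕 (ConjClasses.mk (φ a)) := by
  rw [carriesClass_mk_iff, carriesClass_mk_iff, h, Set.image_singleton, MonoidHom.map_zpowers]

theorem isPullback_singleton_bot {φ : K →* F} (hφ : Function.Injective φ) :
    IsPullback φ {⊥} {⊥} := by
  intro ℬ
  simp only [Carries, Set.forall_mem_image, Set.mem_singleton_iff, exists_eq_left,
    Subgroup.map_bot, le_bot_iff, exists_const, Subgroup.map_eq_bot_iff_of_injective _ hφ]

theorem IsPullback.of_carries {φ : K →* F} {𝓕 : Set (Subgroup F)} {𝓖 𝓖' : Set (Subgroup K)}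
    (h : IsPullback φ 𝓕 𝓖) (h₁ : Carries 𝓖' 𝓖) (h₂ : Carries 𝓖 𝓖') : IsPullback φ 𝓕 𝓖' :=
  fun ℬ => Iff.trans ⟨h₂.trans, h₁.trans⟩ (h ℬ)

theorem isPullback_range_comap_conj {φ : K →* F} {H : ι → Subgroup F} {R : ι → Set F}
    (hR : ∀ k x, ∃ r ∈ R k, ∃ a : K, ∃ b ∈ H k, x = φ a * r * b) :
    IsPullback φ (Set.range H) (Set.range fun i : Σ k, R k =>
      ((H i.1).map (MulAut.conj (i.2 : F)).toMonoidHom).comap φ) := by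
  refine fun ℬ => ⟨fun h => ?_, fun h C hC => ?_⟩
  · refine Carries.trans ?_ (h.map φ)
    rintro _ ⟨_, ⟨i, rfl⟩, rfl⟩
    exact ⟨_, ⟨i.1, rfl⟩, i.2, Subgroup.map_comap_le _ _⟩
  · obtain ⟨_, ⟨k, rfl⟩, x, hx⟩ := h _ ⟨C, hC, rfl⟩
    obtain ⟨r, hr, a, b, hb, rfl⟩ := hR k x
    refine ⟨_, ⟨⟨k, r, hr⟩, rfl⟩, a, fun c hc => ?_⟩
    have hcb := mul_mem (mul_mem hb (mem_map_conj_iff.1 (hx ⟨c, hc, rfl⟩))) (inv_mem hb)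
    refine mem_map_conj_iff.2 (Subgroup.mem_comap.2 (mem_map_conj_iff.2 ?_))
    simpa [mul_assoc] using hcb

theorem IsFreeFactorFamily.exists_isPullback [IsFreeGroup K] [Finite (IsFreeGroup.Generators K)]
    [Nonempty ι] {H : ι → Subgroup F} (hH : IsFreeFactorFamily H) {φ : K →* F}
    (hφ : Function.Injective φ) :
    ∃ 𝓖, IsFreeFactorSystem 𝓖 ∧ IsPullback φ (Set.range H) 𝓖 := by
  obtain ⟨R, hP, hR⟩ := hH.exists_comap_conj hφ
  obtain ⟨k⟩ := ‹Nonempty ι›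
  obtain ⟨r, hr, -⟩ := hR k 1
  have : Nonempty (Σ k, R k) := ⟨k, r, hr⟩
  obtain ⟨𝓖, h𝓖, hcarry, hcarry'⟩ := hP.exists_isFreeFactorSystem_carries_range
  exact ⟨𝓖, h𝓖, (isPullback_range_comap_conj hR).of_carries hcarry hcarry'⟩

theorem IsFreeFactorSystem.exists_isPullback {A : Subgroup F} [IsFreeGroup A]
    [Finite (IsFreeGroup.Generators A)] (hA : IsFreeFactor A) {φ : A →* F}
    (hφ : Function.Injective φ) {𝓕 : Set (Subgroup A)} (h𝓕 : IsFreeFactorSystem 𝓕) :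
    ∃ 𝓖, IsFreeFactorSystem 𝓖 ∧ IsPullback φ (inAmbient 𝓕) 𝓖 := by
  obtain rfl | ⟨h𝓕_nonempty, -, -, h𝓕_fam⟩ := h𝓕
  · refine ⟨{⊥}, Or.inl rfl, ?_⟩
    simpa only [inAmbient, Set.image_singleton, Subgroup.map_bot] using isPullback_singleton_bot hφ
  · have := h𝓕_nonempty.to_subtype
    rw [inAmbient, Set.image_eq_range]
    exact (IsFreeFactorFamily.map_subtype hA h𝓕_fam).exists_isPullback hφ

end Pullback

section PullbackTower

variable {F : Type*} [Group F] {A : Subgroup F} {φ : A →* F} {𝓢 : ℕ → Set (Subgroup A)}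

/-- `𝓢 n` is the `n`-th iterated pullback along `φ` of the free factor system `{A}` of `A`. -/
structure IsPullbackTower (φ : A →* F) (𝓢 : ℕ → Set (Subgroup A)) : Prop where
  zero : 𝓢 0 = {⊤}
  isFreeFactorSystem (n : ℕ) : IsFreeFactorSystem (𝓢 n)
  isPullback (n : ℕ) : IsPullback φ (inAmbient (𝓢 n)) (𝓢 (n + 1))

theorem exists_isPullbackTower [IsFreeGroup A] [Finite (IsFreeGroup.Generators A)]
    (hA : IsFreeFactor A) (hA_ne : A ≠ ⊥) (hφ : Function.Injective φ) :
    ∃ 𝓢, IsPullbackTower φ 𝓢 := by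
  have := (Subgroup.nontrivial_iff_ne_bot A).2 hA_ne
  choose pullback hsystem hpullback using
    fun 𝓕 : {𝓕 : Set (Subgroup A) // IsFreeFactorSystem 𝓕} => 𝓕.2.exists_isPullback hA hφ
  let next (𝓕 : {𝓕 : Set (Subgroup A) // IsFreeFactorSystem 𝓕}) :
      {𝓕 : Set (Subgroup A) // IsFreeFactorSystem 𝓕} := ⟨pullback 𝓕, hsystem 𝓕⟩
  let tower (n : ℕ) := next^[n] ⟨{⊤}, isFreeFactorSystem_singleton_top⟩
  refine ⟨fun n => tower n, rfl, fun n => (tower n).2, fun n => ?_⟩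
  rw [show tower (n + 1) = next (tower n) from Function.iterate_succ_apply' next n _]
  exact hpullback (tower n)

theorem HasForwardIterates.mono {m n : ℕ} (hmn : m ≤ n) {c : ConjClasses F}
    (h : HasForwardIterates φ n c) : HasForwardIterates φ m c := by
  induction n, hmn using Nat.le_induction with
  | base => exact h
  | succ n _ ih =>
    obtain ⟨_, ⟨_⟩ | ⟨_, _, a, ha⟩⟩ := h
    exact ih ⟨_, ha⟩

theorem exists_lt_of_forall_lt_or {P : ℕ → Prop} {κ : ℕ → ℕ} (h : ∀ n, κ (n + 1) < κ n ∨ P n)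
    {N : ℕ} (hN : κ 0 < N) : ∃ n < N, P n := by
  by_contra! hP
  have hdescent (n : ℕ) (hn : n ≤ N) : κ n + n ≤ κ 0 := by
    induction n with
    | zero => rfl
    | succ n ih =>
      have := ih (by lia)
      have := (h n).resolve_right (hP n hn)
      lia
  have := hdescent N le_rfl
  lia

namespace IsPullbackTower

theorem carries_succ_iff (h𝓢 : IsPullbackTower φ 𝓢) {n : ℕ} :
    Carries (𝓢 (n + 1)) (𝓢 n) ↔ IsInvariantSystem φ (𝓢 n) :=
  h𝓢.isPullback n (𝓢 n)

theorem carries_succ (h𝓢 : IsPullbackTower φ 𝓢) (n : ℕ) : Carries (𝓢 n) (𝓢 (n + 1)) := by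
  induction n with
  | zero => exact h𝓢.zero ▸ carries_singleton_top
  | succ n ih =>
    refine (h𝓢.isPullback n _).2 ((ih.map A.subtype).trans ?_)
    exact (h𝓢.isPullback (n + 1) _).1 (carries_of_subset subset_rfl)

theorem carries_of_isInvariantSystem (h𝓢 : IsPullbackTower φ 𝓢) {ℬ : Set (Subgroup A)}
    (hℬ : IsInvariantSystem φ ℬ) (n : ℕ) : Carries (𝓢 n) ℬ := by
  induction n with
  | zero => exact h𝓢.zero ▸ carries_singleton_top
  | succ n ih => exact (h𝓢.isPullback n ℬ).2 ((ih.map A.subtype).trans hℬ)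

theorem exists_isInvariantSystem [IsFreeGroup A] [Finite (IsFreeGroup.Generators A)]
    (h𝓢 : IsPullbackTower φ 𝓢) (hA_ne : A ≠ ⊥) :
    ∃ n < 2 * freeGroupRank A, IsInvariantSystem φ (𝓢 n) := by
  have hpos : 0 < freeGroupRank A :=
    freeGroupRank_pos_iff.2 ((Subgroup.nontrivial_iff_ne_bot A).2 hA_ne)
  have hzero : systemComplexity (𝓢 0) < 2 * freeGroupRank A := by
    rw [h𝓢.zero, systemComplexity_singleton, freeGroupRank_congr Subgroup.topEquiv]
    lia
  have hdrop (n : ℕ) :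
      systemComplexity (𝓢 (n + 1)) < systemComplexity (𝓢 n) ∨ IsInvariantSystem φ (𝓢 n) := by
    rw [← h𝓢.carries_succ_iff]
    exact (h𝓢.isFreeFactorSystem n).complexity_lt_or_carries (h𝓢.isFreeFactorSystem (n + 1))
      (h𝓢.carries_succ n)
  exact exists_lt_of_forall_lt_or (κ := fun n => systemComplexity (𝓢 n)) hdrop hzero

theorem carriesClass_of_isForwardIterate (h𝓢 : IsPullbackTower φ 𝓢) {n : ℕ}
    {c d : ConjClasses F} (hcd : IsForwardIterate φ n c d) (m : ℕ)
    (hd : CarriesClass (inAmbient (𝓢 m)) d) : CarriesClass (inAmbient (𝓢 (m + n))) c := by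
  induction hcd generalizing m with
  | zero c => exact hd
  | succ n c a _ ih =>
    rw [← add_assoc, add_right_comm]
    exact ih (m + 1) (((h𝓢.isPullback m).carriesClass_iff.2 hd).map A.subtype)

theorem carriesClass_of_hasForwardIterates (h𝓢 : IsPullbackTower φ 𝓢) {n : ℕ}
    {c : ConjClasses F} (hc : HasForwardIterates φ (n + 1) c) :
    CarriesClass (inAmbient (𝓢 n)) c := by
  obtain ⟨_, ⟨_⟩ | ⟨_, _, a, ha⟩⟩ := hc
  have htop : CarriesClass (𝓢 0) (ConjClasses.mk a) := ⟨⊤, h𝓢.zero ▸ rfl, a, trivial, rfl⟩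
  simpa only [zero_add] using h𝓢.carriesClass_of_isForwardIterate ha 0 (htop.map A.subtype)

end IsPullbackTower

end PullbackTower

theorem IsFreeFactor.finite_generators {F : Type*} [Group F] [IsFreeGroup F]
    [Finite (IsFreeGroup.Generators F)] {A : Subgroup F} (hA : IsFreeFactor A) :
    Finite (IsFreeGroup.Generators A) := by
  have h := (IsFreeFactorFamily.map_subtype hA isFreeFactorFamily_top).finite_generators ()
  rwa [← MonoidHom.range_eq_map, Subgroup.range_subtype] at h

theorem mainTheorem11_general {F : Type*} [Group F] (A : Subgroup F) [IsFreeGroup A]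
    [Finite (IsFreeGroup.Generators A)] (hA : IsFreeFactor A) (hA_ne : A ≠ ⊥)
    (φ : A →* F) (hφ : Function.Injective φ) :
    ∃ 𝓕 : Set (Subgroup A),
      IsMaximalInvariantFreeFactorSystem φ 𝓕 ∧
      (∀ 𝓖 : Set (Subgroup A), IsMaximalInvariantFreeFactorSystem φ 𝓖 →
        Carries 𝓕 𝓖 ∧ Carries 𝓖 𝓕) ∧
      (∀ c : ConjClasses F, HasForwardIterates φ (2 * freeGroupRank A) c →
        CarriesClass (inAmbient 𝓕) c) ∧
      (∀ ℬ : Set (Subgroup A), IsSubgroupSystem ℬ → IsInvariantSystem φ ℬ →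
        Carries 𝓕 ℬ) := by
  obtain ⟨𝓢, h𝓢⟩ := exists_isPullbackTower hA hA_ne hφ
  obtain ⟨n, hn, hinv⟩ := h𝓢.exists_isInvariantSystem hA_ne
  have hcarry {ℬ : Set (Subgroup A)} (hℬ : IsInvariantSystem φ ℬ) : Carries (𝓢 n) ℬ :=
    h𝓢.carries_of_isInvariantSystem hℬ n
  have hsystem : IsFreeFactorSystem (𝓢 n) := h𝓢.isFreeFactorSystem n
  refine ⟨𝓢 n, ⟨hsystem, hinv, fun ℬ _ hℬ _ => hcarry hℬ⟩, fun 𝓖 h𝓖 => ?_, fun c hc => ?_,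
    fun ℬ _ hℬ => hcarry hℬ⟩
  · exact ⟨hcarry h𝓖.2.1, h𝓖.2.2 _ hsystem hinv (hcarry h𝓖.2.1)⟩
  · exact h𝓢.carriesClass_of_hasForwardIterates (hc.mono hn)

theorem mainTheorem11 {F : Type*} [Group F] [IsFreeGroup F]
    [Finite (IsFreeGroup.Generators F)] (A : Subgroup F) (hA : IsFreeFactor A) (hA_ne : A ≠ ⊥)
    (φ : A →* F) (hφ : Function.Injective φ) :
    ∃ 𝓕 : Set (Subgroup A),
      IsMaximalInvariantFreeFactorSystem φ 𝓕 ∧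
      (∀ 𝓖 : Set (Subgroup A), IsMaximalInvariantFreeFactorSystem φ 𝓖 →
        Carries 𝓕 𝓖 ∧ Carries 𝓖 𝓕) ∧
      (∀ c : ConjClasses F, HasForwardIterates φ (2 * freeGroupRank A) c →
        CarriesClass (inAmbient 𝓕) c) ∧
      (∀ ℬ : Set (Subgroup A), IsSubgroupSystem ℬ → IsInvariantSystem φ ℬ →
        Carries 𝓕 ℬ) := by
  have := hA.finite_generators
  exact mainTheorem11_general A hA hA_ne φ hφ
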